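/- **Conventions.** $\mathbb N=\{0,1,2,\dots\}$. Let $\mathcal V$ be a monoidal category with unit $I$. A family of morphisms $(\beta_i:B\to B_i)_{i\in J}$ is *jointly monic* if for all $f,g:Z\to B$, $\beta_i f=\beta_i g$ for all $i\in J$ implies $f=g$. The monoidal product is *very flat* if for every object $A$ both functors $-\otimes A$ and $A\otimes-$ send jointly monic families (indexed by nonempty sets) to jointly monic families. $\mathcal V$ is *closed* if every functor $A\otimes -$ has a right adjoint. Write $V^{\otimes 0}=I$, $V^{\otimes (k+1)}=V^{\otimes k}\otimes V$, and identify $V^{\otimes 1}\cong V$ and $V^{\otimes(k+l)}\cong V^{\otimes k}\otimes V^{\otimes l}$ by the canonical isomorphisms. A *coalgebra* in $\mathcal V$ is a coassociative counital comonoid $(C,\Delta,\epsilon)$; put $\Delta^0=\epsilon$ and $\Delta^{n}=(\Delta^{n-1}\otimes \mathrm{id}_C)\circ\Delta:C\to C^{\otimes n}$ for $n>0$. A *cofree coalgebra* over $V$ is a coalgebra $T^c(V)$ with a morphism $p:T^c(V)\to V$ such that for every coalgebra $D$ and every morphism $\gamma:D\to V$ there is a unique coalgebra morphism $u:D\to T^c(V)$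 with $p\circ u=\gamma$. **Theorem 2.4.** Let $\mathcal V$ be a closed monoidal and locally presentable category with very flat monoidal product, let $V$ be an object of $\mathcal V$, and let $\pi_n:\prod_{k\in\mathbb N}V^{\otimes k}\to V^{\otimes n}$ be the projections. Call a morphism $\Delta:C\to C\otimes C$ *compatible* with a subobject $c:C\to\prod_{k\in\mathbb N}V^{\otimes k}$ if $$(\pi_k\otimes\pi_l)\circ(c\otimes c)\circ\Delta=\pi_{k+l}\circ c\qquad\text{for all }k,l\in\mathbb N .$$ 1. Among the subobjects of $\prod_{k\in\mathbb N}V^{\otimes k}$ that admit a compatible morphism there is a largest one. 2. Let $c:C\to\prod_{k\in\mathbb N}V^{\otimes k}$ represent this largest subobject, let $\Delta$ be a morphism compatible with it (one exists), and put $p=\pi_1\circ c:C\to V$. Then $(C,\Delta,\pi_0\circ c)$ is a coalgebra, it is the cofree coalgebra over $V$ by means of $p$, and the family $(p^{\otimes k}\circ\Delta^k:C\to V^{\otimes k})_{k\in\mathbb N}$ is jointly monic. 3. Consequently the forgetful functor $U$ from coalgebras in $\mathcal V$ to $\mathcal V$ has a right adjoint. For every right adjoint $T^c$ of $U$, with any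 adjunction $U\dashv T^c$, there is a monomorphism $c:T^c(V)\to\prod_{k\in\mathbb N}V^{\otimes k}$ which represents the largest subobject of part 1, with which the comultiplication of $T^c(V)$ is compatible, and such that the counit of the coalgebra $T^c(V)$ is $\pi_0\circ c$ and the counit of the adjunction at $V$ is $p=\pi_1\circ c$; the morphisms $p^{\otimes k}\circ\Delta^k:T^c(V)\to V^{\otimes k}$ $(k\in\mathbb N)$ are jointly monic. -/

import Mathlib

open CategoryTheory MonoidalCategory Limits

universe w v u

namespace CofreeCoalgebra

/-- A locally presentable category is complete (it is a reflective subcategory of a category of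
presheaves). -/
theorem hasLimits_of_isLocallyPresentable (C : Type u) [Category.{v} C]
    [IsLocallyPresentable.{v} C] : HasLimitsOfSize.{v, v} C := by
  obtain ⟨κ, _, _⟩ := IsLocallyPresentable.exists_cardinal.{v} C
  let A : SmallModel.{v} (isCardinalPresentable C κ).FullSubcategory ⥤ C :=
    (equivSmallModel.{v} (isCardinalPresentable C κ).FullSubcategory).inverse ⋙
      (isCardinalPresentable C κ).ι
  let adj := Presheaf.uliftYonedaAdjunction.{v} _
    (uliftYoneda.{v}.leftKanExtensionUnit A)
  let _ : Reflective (Presheaf.restrictedULiftYoneda.{v} A) := { L := _, adj := adj }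
  exact hasLimits_of_reflective (Presheaf.restrictedULiftYoneda.{v} A)

/-- In particular, a locally presentable category has products of sequences of objects. -/
instance hasLimitsOfShape_nat (C : Type u) [Category.{v} C] [IsLocallyPresentable.{v} C] :
    HasLimitsOfShape (Discrete ℕ) C := by
  have := hasLimits_of_isLocallyPresentable C
  exact hasLimitsOfShape_of_essentiallySmall.{v} (Discrete ℕ) C

variable {C : Type u} [Category.{v} C]

/-- A family of morphisms with common domain is jointly monic if two parallel morphisms into the
domain agree as soon as all their composites with the members of the family agree. -/
def JointlyMonic {ι : Type w} {B : C} {D : ι → C} (β : ∀ i, B ⟶ D i) : Prop :=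
  ∀ ⦃Z : C⦄ (f g : Z ⟶ B), (∀ i, f ≫ β i = g ≫ β i) → f = g

variable [MonoidalCategory C]

/-- `- ⊗ A` preserves jointly monic families (indexed by nonempty small sets). -/
def IsLeftVeryFlat (A : C) : Prop :=
  ∀ ⦃ι : Type v⦄ [Nonempty ι] ⦃B : C⦄ ⦃D : ι → C⦄ (β : ∀ i, B ⟶ D i),
    JointlyMonic β → JointlyMonic (fun i => β i ▷ A)

/-- `A ⊗ -` preserves jointly monic families (indexed by nonempty small sets). -/
def IsRightVeryFlat (A : C) : Prop :=
  ∀ ⦃ι : Type v⦄ [Nonempty ι] ⦃B : C⦄ ⦃D : ι → C⦄ (β : ∀ i, B ⟶ D i),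
    JointlyMonic β → JointlyMonic (fun i => A ◁ β i)

variable (C) in
/-- The monoidal product is very flat: all objects are very flat, on both sides. -/
class HasVeryFlatTensor : Prop where
  left : ∀ A : C, IsLeftVeryFlat A
  right : ∀ A : C, IsRightVeryFlat A

/-- The tensor power `V^{⊗ n}`, bracketed to the left, with `V^{⊗ 0} = I`. -/
def tensorPow (V : C) : ℕ → C
  | 0 => 𝟙_ C
  | n + 1 => tensorPow V n ⊗ V

/-- The canonical isomorphism `V^{⊗ 1} = I ⊗ V ≅ V`. -/
def tensorPowOne (V : C) : tensorPow V 1 ≅ V := λ_ V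

/-- The canonical isomorphism `V^{⊗ (k + l)} ≅ V^{⊗ k} ⊗ V^{⊗ l}`. -/
def tensorPowAdd (V : C) (k : ℕ) : ∀ l : ℕ, tensorPow V (k + l) ≅ tensorPow V k ⊗ tensorPow V l
  | 0 => (ρ_ (tensorPow V k)).symm
  | l + 1 => whiskerRightIso (tensorPowAdd V k l) V ≪≫ α_ (tensorPow V k) (tensorPow V l) V

/-- The tensor power `f^{⊗ n}` of a morphism. -/
def tensorPowMap {V W : C} (f : V ⟶ W) : ∀ n : ℕ, tensorPow V n ⟶ tensorPow W n
  | 0 => 𝟙 (𝟙_ C)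
  | n + 1 => tensorPowMap f n ⊗ₘ f

/-- The iterated comultiplication `Δⁿ : X ⟶ X^{⊗ n}` of a coalgebra: `Δ⁰ = ε` and
`Δⁿ⁺¹ = (Δⁿ ⊗ id) ∘ Δ`. -/
def comulPow (X : C) [ComonObj X] : ∀ n : ℕ, X ⟶ tensorPow X n
  | 0 => ComonObj.counit
  | n + 1 => ComonObj.comul ≫ (comulPow X n ▷ X)

/-- `(T, p)` is a cofree coalgebra over `V`: every morphism from a coalgebra to `V` factors through
`p` by a unique coalgebra morphism. -/
def IsCofree (V : C) (T : Comon C) (p : T.X ⟶ V) : Prop :=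
  ∀ (D : Comon C) (γ : D.X ⟶ V), ∃! f : D ⟶ T, f.hom ≫ p = γ

section Product

variable [HasLimitsOfShape (Discrete ℕ) C]

/-- The product `∏ₖ V^{⊗ k}` over all natural numbers `k`. -/
noncomputable def prodPow (V : C) : C := ∏ᶜ (fun k : ℕ => tensorPow V k)

/-- The projection `∏ₖ V^{⊗ k} ⟶ V^{⊗ n}`. -/
noncomputable def proj (V : C) (n : ℕ) : prodPow V ⟶ tensorPow V n :=
  Pi.π (fun k : ℕ => tensorPow V k) n

/-- `(π_k ⊗ π_l) ∘ (c ⊗ c) ∘ Δ = π_{k+l} ∘ c` for all `k` and `l`, up to the canonical isomorphism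
`V^{⊗ (k + l)} ≅ V^{⊗ k} ⊗ V^{⊗ l}`. -/
def IsCompatible {V X : C} (c : X ⟶ prodPow V) (Δ : X ⟶ X ⊗ X) : Prop :=
  ∀ k l : ℕ, Δ ≫ (c ⊗ₘ c) ≫ (proj V k ⊗ₘ proj V l) =
    c ≫ proj V (k + l) ≫ (tensorPowAdd V k l).hom

/-- The subobjects `c : X ⟶ ∏ₖ V^{⊗ k}` for which a compatible morphism `X ⟶ X ⊗ X` exists. -/
def compatibleSubobjects (V : C) : Set (Subobject (prodPow V)) :=
  {S | ∃ Δ : (S : C) ⟶ (S : C) ⊗ (S : C), IsCompatible S.arrow Δ}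

end Product

end CofreeCoalgebra

/-! A morphism `c` into the product is a sequence of components `x n`, and compatibility says that
`Δ` splits `x (k + l)` into `x k ⊗ x l`. If `c` is monic, the components are jointly monic, and by
very flatness so are their twofold and threefold tensor products. Hence the coalgebra axioms, and
the fact that a map is a coalgebra morphism, can be tested on components, where they reduce to
coherence of the tensor powers (`IsMultiplicative.comonObj`, `IsMultiplicative.comp_comul`).

The largest compatible subobject is approached from above (`exists_universal_isCompatible`):
intersect all subobjects through which every compatible morphism, monic or not, factors. Minimality
of the intersection forces it to carry a compatible morphism itself. No unions or images are needed.

Cofreeness follows because a coalgebra `D` with `γ : D ⟶ V` yields the compatible morphism with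
components `γ^{⊗ k} ∘ Δ^k`, which therefore factors through the largest subobject. -/

namespace CofreeCoalgebra

/-! ### Well-poweredness and intersections of subobjects -/

section Subobjects

/-- A strong generator is detecting. -/
theorem isDetecting_of_isStrongGenerator {C : Type u} [Category.{v} C] {P : ObjectProperty C}
    (hP : P.IsStrongGenerator) : P.IsDetecting := by
  intro X Y f hf
  -- For `k` out of a generator, `k ≫ g` and `k ≫ h` both lift `k ≫ g ≫ f` through `f`, and such
  -- lifts are unique.
  have : Mono f := ⟨fun {Z} g h w => by
    refine hP.isSeparating g h fun G hG k => ?_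
    obtain ⟨_, -, huniq⟩ := hf G hG (k ≫ g ≫ f)
    exact (huniq (k ≫ g) (by simp)).trans (huniq (k ≫ h) (by simp [w])).symm⟩
  exact hP.isIso_of_mono f fun G hG h => (hf G hG h).exists

/-- A locally presentable category is well-powered. -/
theorem wellPowered_of_isLocallyPresentable (C : Type u) [Category.{v} C]
    [IsLocallyPresentable.{v} C] : WellPowered.{v} C := by
  obtain ⟨κ, _, _⟩ := IsLocallyPresentable.exists_cardinal.{v} C
  have := hasLimits_of_isLocallyPresentable C
  obtain ⟨P, _, hP⟩ := HasCardinalFilteredGenerator.exists_small_generator C κ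
  have := hasFiniteLimits_of_hasLimitsOfSize.{v, v} C
  exact wellPowered_of_isDetecting (isDetecting_of_isStrongGenerator hP.isStrongGenerator)

/-- A morphism factors through an intersection of subobjects if it factors through each of them. -/
theorem factors_sInf {C : Type u} [Category.{v} C] [WellPowered.{v} C] [HasWidePullbacks.{v} C]
    {A D : C} (s : Set (Subobject A)) (f : D ⟶ A) (hf : ∀ S ∈ s, S.Factors f) :
    (Subobject.sInf.{v} s).Factors f := by
  have hs : ∀ j : equivShrink.{v} (Subobject A) '' s,
      ((equivShrink.{v} (Subobject A)).symm j).Factors f := by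
    rintro ⟨_, S, hS, rfl⟩
    simpa using hf S hS
  let c : Cone (Subobject.wideCospan.{v} s) := WidePullbackShape.mkCone f
    (fun j => Subobject.factorThru _ f (hs j)) fun j => Subobject.factorThru_arrow _ _ _
  exact (Subobject.mk_factors_iff (Subobject.widePullbackι.{v} s) f).2
    ⟨limit.lift (Subobject.wideCospan.{v} s) c, limit.lift_π c none⟩

end Subobjects

/-! ### Joint monicity under tensoring, and coherence of tensor powers -/

section Tensor

variable {C : Type u} [Category.{v} C]

/-- Joint monicity of a family does not depend on the universe level of the index type. -/
theorem JointlyMonic.comp_equiv {ι ι' : Type*} (e : ι' ≃ ι) {B : C} {D : ι → C}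
    {β : ∀ i, B ⟶ D i} (h : JointlyMonic β) : JointlyMonic (fun i => β (e i)) :=
  fun _ f g w => h f g fun i => by
    obtain ⟨i, rfl⟩ := e.surjective i
    exact w i

variable [MonoidalCategory C]

theorem JointlyMonic.whiskerRight [HasVeryFlatTensor C] {B : C} {D : ℕ → C}
    {β : ∀ n, B ⟶ D n} (h : JointlyMonic β) (A : C) : JointlyMonic (fun n => β n ▷ A) :=
  (HasVeryFlatTensor.left A _ (h.comp_equiv Equiv.ulift.{v})).comp_equiv Equiv.ulift.{v}.symm

theorem JointlyMonic.whiskerLeft [HasVeryFlatTensor C] {B : C} {D : ℕ → C}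
    {β : ∀ n, B ⟶ D n} (h : JointlyMonic β) (A : C) : JointlyMonic (fun n => A ◁ β n) :=
  (HasVeryFlatTensor.right A _ (h.comp_equiv Equiv.ulift.{v})).comp_equiv Equiv.ulift.{v}.symm

/-- The pairwise tensor products of the members of two jointly monic families detect equality. -/
theorem JointlyMonic.tensor [HasVeryFlatTensor C] {B B' : C} {D D' : ℕ → C}
    {β : ∀ n, B ⟶ D n} {β' : ∀ n, B' ⟶ D' n} (h : JointlyMonic β) (h' : JointlyMonic β')
    {Z : C} (f g : Z ⟶ B ⊗ B') (w : ∀ k l, f ≫ (β k ⊗ₘ β' l) = g ≫ (β k ⊗ₘ β' l)) : f = g := by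
  -- Factor `β k ⊗ β' l` as `B ◁ β' l` followed by `β k ▷ D' l`; each whiskered family is jointly
  -- monic.
  refine h'.whiskerLeft B f g fun l => h.whiskerRight (D' l) _ _ fun k => ?_
  simpa [tensorHom_def'] using w k l

/-- The tensor products of three members of a jointly monic family detect equality. -/
theorem JointlyMonic.tensor_tensor [HasVeryFlatTensor C] {B : C} {D : ℕ → C}
    {β : ∀ n, B ⟶ D n} (h : JointlyMonic β) {Z : C} (f g : Z ⟶ B ⊗ (B ⊗ B))
    (w : ∀ k l m, f ≫ (β k ⊗ₘ (β l ⊗ₘ β m)) = g ≫ (β k ⊗ₘ (β l ⊗ₘ β m))) : f = g := by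
  refine h.whiskerRight (B ⊗ B) _ _ fun k => (h.whiskerLeft B).whiskerLeft (D k) _ _ fun m =>
    (h.whiskerRight (D m)).whiskerLeft (D k) _ _ fun l => ?_
  have := w k l m
  simpa [tensorHom_def (β k), tensorHom_def' (β l)] using this

variable {V : C}

/-- The cast is needed because `0 + l` does not reduce to `l`. At `l + 1` it is the cast at `l`
whiskered with `V`, which makes the induction go through. -/
theorem tensorPowAdd_zero_left (V : C) (l : ℕ) :
    (tensorPowAdd V 0 l).hom =
      eqToHom (congrArg (tensorPow V) (Nat.zero_add l)) ≫ (λ_ (tensorPow V l)).inv := by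
  induction l with
  | zero =>
    change (ρ_ (𝟙_ C)).inv = 𝟙 _ ≫ (λ_ (𝟙_ C)).inv
    rw [unitors_inv_equal, Category.id_comp]
  | succ l ih =>
    have e : eqToHom (congrArg (tensorPow V) (Nat.zero_add (l + 1))) =
        eqToHom (congrArg (tensorPow V) (Nat.zero_add l)) ▷ V :=
      (eqToHom_whiskerRight (congrArg (tensorPow V) (Nat.zero_add l)) V).symm
    rw [e]
    change (tensorPowAdd V 0 l).hom ▷ V ≫ (α_ (𝟙_ C) (tensorPow V l) V).hom =
      _ ≫ (λ_ (tensorPow V l ⊗ V)).inv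
    have aux {X Y : C} (f : X ⟶ Y) : (f ≫ (λ_ Y).inv) ▷ V ≫ (α_ (𝟙_ C) Y V).hom =
        f ▷ V ≫ (λ_ (Y ⊗ V)).inv := by simp
    exact (congrArg (fun t => t ▷ V ≫ (α_ (𝟙_ C) (tensorPow V l) V).hom) ih).trans (aux _)

theorem tensorPowAdd_assoc (V : C) (k l m : ℕ) :
    (tensorPowAdd V (k + l) m).hom ≫ (tensorPowAdd V k l).hom ▷ tensorPow V m ≫ (α_ _ _ _).hom =
      eqToHom (congrArg (tensorPow V) (Nat.add_assoc k l m)) ≫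
        (tensorPowAdd V k (l + m)).hom ≫ tensorPow V k ◁ (tensorPowAdd V l m).hom := by
  induction m with
  | zero =>
    change (ρ_ (tensorPow V (k + l))).inv ≫ (tensorPowAdd V k l).hom ▷ 𝟙_ C ≫ (α_ _ _ _).hom =
      𝟙 _ ≫ (tensorPowAdd V k l).hom ≫ tensorPow V k ◁ (ρ_ (tensorPow V l)).inv
    simp
  | succ m ih =>
    have e : eqToHom (congrArg (tensorPow V) (Nat.add_assoc k l (m + 1))) =
        eqToHom (congrArg (tensorPow V) (Nat.add_assoc k l m)) ▷ V :=
      (eqToHom_whiskerRight (congrArg (tensorPow V) (Nat.add_assoc k l m)) V).symm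
    rw [e]
    change ((tensorPowAdd V (k + l) m).hom ▷ V ≫ (α_ (tensorPow V (k + l)) (tensorPow V m) V).hom) ≫
        (tensorPowAdd V k l).hom ▷ (tensorPow V m ⊗ V) ≫ (α_ _ _ _).hom =
      _ ≫ ((tensorPowAdd V k (l + m)).hom ▷ V ≫ (α_ (tensorPow V k) (tensorPow V (l + m)) V).hom) ≫
        tensorPow V k ◁ ((tensorPowAdd V l m).hom ▷ V ≫ (α_ (tensorPow V l) (tensorPow V m) V).hom)
    have h := congrArg (fun t => t ▷ V ≫ (α_ _ _ _).hom ≫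
      tensorPow V k ◁ (α_ (tensorPow V l) (tensorPow V m) V).hom) ih
    simpa using h

end Tensor

end CofreeCoalgebra

namespace CofreeCoalgebra

/-! ### Multiplicative families and comonoids -/

section Multiplicative

theorem comp_eqToHom_of_family {C : Type u} [Category.{v} C] {X : C} {F : ℕ → C} (x : ∀ n, X ⟶ F n) {m n : ℕ} (h : m = n) :
    x m ≫ eqToHom (congrArg F h) = x n := by
  subst h
  simp

variable {C : Type u} [Category.{v} C] [MonoidalCategory C] {V : C}

/-- A family of morphisms `xₙ : X ⟶ V^{⊗ n}` is multiplicative with respect to `Δ : X ⟶ X ⊗ X` if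
`(x_k ⊗ x_l) ∘ Δ = x_{k+l}`, up to the canonical isomorphisms. -/
def IsMultiplicative {X : C} (Δ : X ⟶ X ⊗ X) (x : ∀ n, X ⟶ tensorPow V n) : Prop :=
  ∀ k l : ℕ, Δ ≫ (x k ⊗ₘ x l) = x (k + l) ≫ (tensorPowAdd V k l).hom

/-- A jointly monic multiplicative family turns its domain into a comonoid. -/
@[reducible]
def IsMultiplicative.comonObj [HasVeryFlatTensor C] {X : C} {Δ : X ⟶ X ⊗ X}
    {x : ∀ n, X ⟶ tensorPow V n} (h : IsMultiplicative Δ x) (hx : JointlyMonic x) :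
    ComonObj X where
  counit := x 0
  comul := Δ
  counit_comul := by
    refine hx.whiskerLeft (𝟙_ C) _ _ fun l => ?_
    have aux {A : C} (e : X ⟶ 𝟙_ C) (a : X ⟶ A) (w : Δ ≫ (e ⊗ₘ a) = a ≫ (λ_ A).inv) :
        (Δ ≫ e ▷ X) ≫ 𝟙_ C ◁ a = (λ_ X).inv ≫ 𝟙_ C ◁ a := by
      rw [Category.assoc, ← MonoidalCategory.tensorHom_def, w, leftUnitor_inv_naturality]
    refine aux (x 0) (x l) ((h 0 l).trans ?_)
    refine (congrArg (x (0 + l) ≫ ·) (tensorPowAdd_zero_left V l)).trans ?_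
    exact (Category.assoc _ _ _).symm.trans
      (congrArg (· ≫ (λ_ (tensorPow V l)).inv) (comp_eqToHom_of_family x (Nat.zero_add l)))
  comul_counit := by
    refine hx.whiskerRight (𝟙_ C) _ _ fun k => ?_
    have := h k 0
    rw [tensorHom_def'] at this
    rw [Category.assoc]
    exact this.trans (rightUnitor_inv_naturality _)
  comul_assoc := by
    -- On components both sides are `x (k + l + m)`, rebracketed in two ways that
    -- `tensorPowAdd_assoc` identifies.
    refine hx.tensor_tensor _ _ fun k l m => ?_
    have lhs : (Δ ≫ X ◁ Δ) ≫ (x k ⊗ₘ (x l ⊗ₘ x m)) =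
        x (k + (l + m)) ≫ (tensorPowAdd V k (l + m)).hom ≫
          tensorPow V k ◁ (tensorPowAdd V l m).hom := by
      rw [← reassoc_of% (h k (l + m)), Category.assoc, ← id_tensorHom, ← id_tensorHom,
        tensorHom_comp_tensorHom, tensorHom_comp_tensorHom, h l m, Category.id_comp,
        Category.comp_id]
    have rhs : (Δ ≫ Δ ▷ X ≫ (α_ X X X).hom) ≫ (x k ⊗ₘ (x l ⊗ₘ x m)) =
        x (k + l + m) ≫ (tensorPowAdd V (k + l) m).hom ≫
          (tensorPowAdd V k l).hom ▷ tensorPow V m ≫ (α_ _ _ _).hom := by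
      rw [← reassoc_of% (h (k + l) m), Category.assoc, Category.assoc, ← associator_naturality,
        ← tensorHom_id, ← tensorHom_id, tensorHom_comp_tensorHom_assoc,
        tensorHom_comp_tensorHom_assoc, h k l, Category.id_comp, Category.comp_id]
    rw [lhs, rhs, tensorPowAdd_assoc, ← Category.assoc (x (k + l + m)),
      comp_eqToHom_of_family x (Nat.add_assoc k l m)]

/-- A morphism intertwining two multiplicative families, the second one jointly monic, is
compatible with the comultiplications. -/
theorem IsMultiplicative.comp_comul [HasVeryFlatTensor C] {X D : C} {Δ : X ⟶ X ⊗ X}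
    {Δ' : D ⟶ D ⊗ D} {x : ∀ n, X ⟶ tensorPow V n} {d : ∀ n, D ⟶ tensorPow V n}
    (h : IsMultiplicative Δ x) (hx : JointlyMonic x) (hd : IsMultiplicative Δ' d) (f : D ⟶ X)
    (w : ∀ n, f ≫ x n = d n) : f ≫ Δ = Δ' ≫ (f ⊗ₘ f) := by
  refine hx.tensor hx _ _ fun k l => ?_
  rw [Category.assoc, Category.assoc, h k l, tensorHom_comp_tensorHom, w k, w l, hd k l,
    ← Category.assoc, w]

theorem tensorPowAdd_one (V : C) (k : ℕ) :
    (tensorPowAdd V k 1).hom ≫ tensorPow V k ◁ (tensorPowOne V).hom = 𝟙 (tensorPow V (k + 1)) := by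
  have : (ρ_ (tensorPow V k)).inv ▷ V ≫ (α_ (tensorPow V k) (𝟙_ C) V).hom ≫
      tensorPow V k ◁ (λ_ V).hom = 𝟙 (tensorPow V k ⊗ V) := by simp
  exact (Category.assoc _ _ _).trans this

/-- A multiplicative family on a comonoid which starts with the counit consists of the tensor
powers of its member of degree one. -/
theorem IsMultiplicative.comulPow_eq {X : C} [ComonObj X] {x : ∀ n, X ⟶ tensorPow V n}
    (h : IsMultiplicative ComonObj.comul x) (h₀ : x 0 = ComonObj.counit) (k : ℕ) :
    comulPow X k ≫ tensorPowMap (x 1 ≫ (tensorPowOne V).hom) k = x k := by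
  induction k with
  | zero => exact (Category.comp_id _).trans h₀.symm
  | succ k ih =>
    have key : (ComonObj.comul ≫ comulPow X k ▷ X) ≫
        (tensorPowMap (x 1 ≫ (tensorPowOne V).hom) k ⊗ₘ (x 1 ≫ (tensorPowOne V).hom)) =
        x (k + 1) ≫ (tensorPowAdd V k 1).hom ≫ tensorPow V k ◁ (tensorPowOne V).hom := by
      rw [← reassoc_of% (h k 1), ← tensorHom_id, ← id_tensorHom, Category.assoc,
        tensorHom_comp_tensorHom, tensorHom_comp_tensorHom, Category.id_comp, Category.comp_id, ih]
    exact key.trans ((congrArg (x (k + 1) ≫ ·) (tensorPowAdd_one V k)).trans (Category.comp_id _))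

/-- The iterated comultiplications, composed with the tensor powers of a morphism, form a
multiplicative family. -/
theorem isMultiplicative_comulPow (D : C) [ComonObj D] (γ : D ⟶ V) :
    IsMultiplicative ComonObj.comul (fun k => comulPow D k ≫ tensorPowMap γ k) := by
  intro k l
  induction l with
  | zero =>
    have h₀ : comulPow D 0 ≫ tensorPowMap γ 0 = (ComonObj.counit : D ⟶ 𝟙_ C) :=
      Category.comp_id _
    exact (congrArg (fun t => ComonObj.comul ≫ ((comulPow D k ≫ tensorPowMap γ k) ⊗ₘ t)) h₀).trans
      (ComonObj.comul_counit_hom _)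
  | succ l ih =>
    -- Coassociativity moves the last tensor factor outside, so that the case `l` applies to the
    -- first two.
    have aux {A B : C} (a : D ⟶ A) (b : D ⟶ B) (ab : D ⟶ A ⊗ B)
        (hab : ComonObj.comul ≫ (a ⊗ₘ b) = ab) :
        ComonObj.comul ≫ (a ⊗ₘ (ComonObj.comul ≫ (b ⊗ₘ γ))) =
          ComonObj.comul ≫ (ab ⊗ₘ γ) ≫ (α_ A B V).hom := by
      rw [← hab]
      have h₁ : a ⊗ₘ (ComonObj.comul ≫ (b ⊗ₘ γ)) = D ◁ ComonObj.comul ≫ (a ⊗ₘ (b ⊗ₘ γ)) := by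
        rw [← id_tensorHom, tensorHom_comp_tensorHom, Category.id_comp]
      have h₂ : (ComonObj.comul ≫ (a ⊗ₘ b)) ⊗ₘ γ = ComonObj.comul ▷ D ≫ ((a ⊗ₘ b) ⊗ₘ γ) := by
        rw [← tensorHom_id, tensorHom_comp_tensorHom, Category.id_comp]
      rw [h₁, h₂, Category.assoc, associator_naturality, ComonObj.comul_assoc_assoc]
    have hs (n : ℕ) : comulPow D (n + 1) ≫ tensorPowMap γ (n + 1) =
        ComonObj.comul ≫ ((comulPow D n ≫ tensorPowMap γ n) ⊗ₘ γ) := by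
      change (ComonObj.comul ≫ comulPow D n ▷ D) ≫ (tensorPowMap γ n ⊗ₘ γ) = _
      rw [← tensorHom_id, Category.assoc, tensorHom_comp_tensorHom, Category.id_comp]
    have lhs := congrArg (fun t => ComonObj.comul ≫ ((comulPow D k ≫ tensorPowMap γ k) ⊗ₘ t))
      (hs l)
    have rhs := congrArg (fun t => t ≫ (tensorPowAdd V k l).hom ▷ V ≫
      (α_ (tensorPow V k) (tensorPow V l) V).hom) (hs (k + l))
    refine lhs.trans ((aux _ _ _ ih).trans (Eq.trans ?_ rhs.symm))
    simp only [Category.assoc, ← tensorHom_id, tensorHom_comp_tensorHom_assoc, Category.comp_id]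

theorem comulPow_one_comp (D : C) [ComonObj D] (γ : D ⟶ V) :
    (comulPow D 1 ≫ tensorPowMap γ 1) ≫ (tensorPowOne V).hom = γ := by
  have : ((ComonObj.comul ≫ ComonObj.counit ▷ D) ≫ (𝟙 (𝟙_ C) ⊗ₘ γ)) ≫ (λ_ V).hom = γ := by simp
  exact this

/-- The iterated comultiplications are natural in coalgebra morphisms. -/
theorem comulPow_naturality {D X : C} [ComonObj D] [ComonObj X] (f : D ⟶ X) [IsComonHom f]
    (p : X ⟶ V) (k : ℕ) :
    f ≫ comulPow X k ≫ tensorPowMap p k = comulPow D k ≫ tensorPowMap (f ≫ p) k := by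
  induction k with
  | zero =>
    have : f ≫ (ComonObj.counit : X ⟶ 𝟙_ C) ≫ 𝟙 (𝟙_ C) = ComonObj.counit ≫ 𝟙 (𝟙_ C) := by simp
    exact this
  | succ k ih =>
    change f ≫ (ComonObj.comul ≫ comulPow X k ▷ X) ≫ (tensorPowMap p k ⊗ₘ p) =
      (ComonObj.comul ≫ comulPow D k ▷ D) ≫ (tensorPowMap (f ≫ p) k ⊗ₘ (f ≫ p))
    simp only [← tensorHom_id, Category.assoc, tensorHom_comp_tensorHom, Category.id_comp,
      IsComonHom.hom_comul_assoc, ih]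

end Multiplicative

/-! ### Compatible morphisms and the universal compatible subobject -/

section Compatible

variable {C : Type u} [Category.{v} C] [MonoidalCategory C] {V : C}
  [HasLimitsOfShape (Discrete ℕ) C]

theorem isCompatible_iff_isMultiplicative {X : C} {c : X ⟶ prodPow V} {Δ : X ⟶ X ⊗ X} :
    IsCompatible c Δ ↔ IsMultiplicative Δ (fun n => c ≫ proj V n) := by
  simp only [IsCompatible, IsMultiplicative, tensorHom_comp_tensorHom, Category.assoc]

theorem jointlyMonic_comp_proj {X : C} (c : X ⟶ prodPow V) [Mono c] :
    JointlyMonic (fun n => c ≫ proj V n) := fun _ _ _ w =>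
  (cancel_mono c).1 (Pi.hom_ext _ _ fun n =>
    (Category.assoc _ _ _).trans ((w n).trans (Category.assoc _ _ _).symm))

/-- Compatible morphisms are transported along isomorphisms. -/
theorem IsCompatible.precomp_iso {X Y : C} {c : X ⟶ prodPow V} {Δ : X ⟶ X ⊗ X}
    (h : IsCompatible c Δ) (e : Y ≅ X) :
    IsCompatible (e.hom ≫ c) (e.hom ≫ Δ ≫ (e.inv ⊗ₘ e.inv)) := by
  intro k l
  have := h k l
  simp only [Category.assoc, tensorHom_comp_tensorHom, Iso.inv_hom_id_assoc] at this ⊢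
  rw [this]

/-- The morphism into `∏ₖ V^{⊗ k}` given by the iterated comultiplications of a coalgebra and a
morphism to `V`. -/
noncomputable def comulProd (D : C) [ComonObj D] (γ : D ⟶ V) : D ⟶ prodPow V :=
  Pi.lift (fun k => comulPow D k ≫ tensorPowMap γ k)

@[simp]
theorem comulProd_proj (D : C) [ComonObj D] (γ : D ⟶ V) (n : ℕ) :
    comulProd D γ ≫ proj V n = comulPow D n ≫ tensorPowMap γ n :=
  Pi.lift_π _ _

theorem isCompatible_comulProd (D : C) [ComonObj D] (γ : D ⟶ V) :
    IsCompatible (comulProd D γ) ComonObj.comul := by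
  rw [isCompatible_iff_isMultiplicative]
  simpa using isMultiplicative_comulPow D γ

/-- There is a compatible subobject through which all compatible morphisms factor. -/
theorem exists_universal_isCompatible {C : Type u} [Category.{v} C] [MonoidalCategory C]
    [IsLocallyPresentable.{v} C] [HasVeryFlatTensor C] (V : C) :
    ∃ (E : Subobject (prodPow V)) (Δ : (E : C) ⟶ (E : C) ⊗ (E : C)), IsCompatible E.arrow Δ ∧
      ∀ ⦃D : C⦄ (f : D ⟶ prodPow V) (Δ' : D ⟶ D ⊗ D), IsCompatible f Δ' → E.Factors f := by
  have := wellPowered_of_isLocallyPresentable C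
  have := hasLimits_of_isLocallyPresentable C
  have := hasFiniteLimits_of_hasLimits C
  have : HasLimitsOfShape (Discrete (ℕ × ℕ)) C :=
    hasLimitsOfShape_of_essentiallySmall.{v} (Discrete (ℕ × ℕ)) C
  -- Upper bounds for all compatible morphisms; `E` is their intersection, which is again one of
  -- them.
  let s : Set (Subobject (prodPow V)) :=
    {S | ∀ ⦃D : C⦄ (f : D ⟶ prodPow V) (Δ' : D ⟶ D ⊗ D), IsCompatible f Δ' → S.Factors f}
  obtain ⟨E, hEs, hE⟩ : ∃ E ∈ s, ∀ S ∈ s, E ≤ S :=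
    ⟨Subobject.sInf.{v} s, fun D f Δ' h => factors_sInf s f fun S hS => hS f Δ' h,
      Subobject.sInf_le.{v} s⟩
  -- A compatible `Δ` on `E` is exactly a solution of `Δ ≫ m = n`. As `m` is monic by very flatness,
  -- the pullback of `m` along `n` is the subobject of `E` where this can be solved.
  let m : (E : C) ⊗ (E : C) ⟶ ∏ᶜ (fun i : ℕ × ℕ => tensorPow V i.1 ⊗ tensorPow V i.2) :=
    Pi.lift fun i => (E.arrow ≫ proj V i.1) ⊗ₘ (E.arrow ≫ proj V i.2)
  let n : (E : C) ⟶ ∏ᶜ (fun i : ℕ × ℕ => tensorPow V i.1 ⊗ tensorPow V i.2) :=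
    Pi.lift fun i => E.arrow ≫ proj V (i.1 + i.2) ≫ (tensorPowAdd V i.1 i.2).hom
  have hm (i : ℕ × ℕ) : m ≫ Pi.π _ i = (E.arrow ≫ proj V i.1) ⊗ₘ (E.arrow ≫ proj V i.2) :=
    Pi.lift_π _ _
  have hn (i : ℕ × ℕ) :
      n ≫ Pi.π _ i = E.arrow ≫ proj V (i.1 + i.2) ≫ (tensorPowAdd V i.1 i.2).hom := Pi.lift_π _ _
  have : Mono m := ⟨fun f g w =>
    (jointlyMonic_comp_proj E.arrow).tensor (jointlyMonic_comp_proj E.arrow) f g fun k l => by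
      rw [← hm (k, l), reassoc_of% w]⟩
  have hmem : Subobject.mk (pullback.snd m n ≫ E.arrow) ∈ s := by
    intro D f Δ' h
    have hu := Subobject.factorThru_arrow E f (hEs f Δ' h)
    set t := E.factorThru f (hEs f Δ' h)
    -- Compatibility of `f` makes `Δ' ≫ (t ⊗ t)` and `t` agree over the pullback.
    refine (Subobject.mk_factors_iff _ _).2 ⟨pullback.lift (Δ' ≫ (t ⊗ₘ t)) t ?_, ?_⟩
    · refine Pi.hom_ext _ _ fun i => ?_
      have := h i.1 i.2
      rw [tensorHom_comp_tensorHom] at this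
      rw [Category.assoc, Category.assoc, Category.assoc, hm, hn, tensorHom_comp_tensorHom,
        reassoc_of% hu, reassoc_of% hu, this, reassoc_of% hu]
    · exact (pullback.lift_snd_assoc _ _ _ _).trans hu
  -- By minimality `E` lies inside the pullback, so the projection to `E` has a section `r`.
  obtain ⟨(r : (E : C) ⟶ pullback m n), (hr : r ≫ pullback.snd m n ≫ E.arrow = E.arrow)⟩ :=
    (Subobject.mk_factors_iff _ _).1
    (Subobject.factors_of_le E.arrow (hE _ hmem) (Subobject.factors_self E))
  replace hr : r ≫ pullback.snd m n = 𝟙 _ :=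
    (cancel_mono E.arrow).1 (by rw [Category.assoc, Category.id_comp, hr])
  refine ⟨E, r ≫ pullback.fst m n, fun k l => ?_, hEs⟩
  rw [tensorHom_comp_tensorHom, ← hm (k, l), Category.assoc, pullback.condition_assoc,
    reassoc_of% hr, hn]

end Compatible

end CofreeCoalgebra

namespace CofreeCoalgebra

/-! ### Cofree coalgebras and the right adjoint -/

section Cofree

variable {C : Type u} [Category.{v} C] [MonoidalCategory C] {V : C}

/-- Compatibility of a subobject does not depend on the representing monomorphism. -/
theorem mk_mem_compatibleSubobjects_iff [HasLimitsOfShape (Discrete ℕ) C] {X : C}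
    (c : X ⟶ prodPow V) [Mono c] :
    Subobject.mk c ∈ compatibleSubobjects V ↔ ∃ Δ : X ⟶ X ⊗ X, IsCompatible c Δ := by
  constructor
  · rintro ⟨Δ, h⟩
    have := h.precomp_iso (Subobject.underlyingIso c).symm
    rw [Iso.symm_hom, Subobject.underlyingIso_arrow] at this
    exact ⟨_, this⟩
  · rintro ⟨Δ, h⟩
    have := h.precomp_iso (Subobject.underlyingIso c)
    rw [Subobject.underlyingIso_hom_comp_eq_mk] at this
    exact ⟨_, this⟩

/-- The counit of an adjunction exhibits the values of a right adjoint as cofree coalgebras. -/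
theorem isCofree_of_adjunction {Tc : C ⥤ Comon C} (adj : Comon.forget C ⊣ Tc) (V : C) :
    IsCofree V (Tc.obj V) (adj.counit.app V) := by
  intro D γ
  refine ⟨adj.homEquiv D V γ, ?_, fun f hf => ?_⟩
  · exact (adj.homEquiv_counit D V _).symm.trans ((adj.homEquiv D V).symm_apply_apply γ)
  · exact ((adj.homEquiv D V).symm_apply_eq).1 ((adj.homEquiv_counit D V f).trans hf)

variable [IsLocallyPresentable.{v} C] [HasVeryFlatTensor C]

theorem exists_isGreatest_compatibleSubobjects (V : C) :
    ∃ S, IsGreatest (compatibleSubobjects V) S := by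
  obtain ⟨E, Δ, hΔ, hE⟩ := exists_universal_isCompatible V
  refine ⟨E, ⟨Δ, hΔ⟩, fun S ⟨Δ', h⟩ => ?_⟩
  exact Subobject.le_of_comm _ (Subobject.factorThru_arrow E S.arrow (hE _ Δ' h))

/-- Every compatible morphism factors through the largest compatible subobject. -/
theorem exists_factorization_of_isGreatest {X D : C} {c : X ⟶ prodPow V} [Mono c]
    (hc : IsGreatest (compatibleSubobjects V) (Subobject.mk c)) {f : D ⟶ prodPow V}
    {Δ : D ⟶ D ⊗ D} (hf : IsCompatible f Δ) : ∃ g : D ⟶ X, g ≫ c = f := by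
  obtain ⟨E, Δ', hΔ', hE⟩ := exists_universal_isCompatible V
  exact (Subobject.mk_factors_iff _ _).1
    (Subobject.factors_of_le f (hc.2 ⟨Δ', hΔ'⟩) (hE f Δ hf))

/-- A compatible structure on the largest compatible subobject is a comonoid structure, and the
resulting coalgebra is cofree. -/
theorem exists_comonObj_of_isGreatest {X : C} (c : X ⟶ prodPow V) [Mono c]
    (hc : IsGreatest (compatibleSubobjects V) (Subobject.mk c)) (Δ : X ⟶ X ⊗ X)
    (hΔ : IsCompatible c Δ) :
    ∃ h : ComonObj X, h.comul = Δ ∧ h.counit = c ≫ proj V 0 ∧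
      IsCofree V (Comon.mk X) (c ≫ proj V 1 ≫ (tensorPowOne V).hom) ∧
      ∀ k, comulPow X k ≫ tensorPowMap (c ≫ proj V 1 ≫ (tensorPowOne V).hom) k =
        c ≫ proj V k := by
  have hm := isCompatible_iff_isMultiplicative.1 hΔ
  have hj := jointlyMonic_comp_proj c
  let inst : ComonObj X := hm.comonObj hj
  have hpow (k : ℕ) : comulPow X k ≫
      tensorPowMap (c ≫ proj V 1 ≫ (tensorPowOne V).hom) k = c ≫ proj V k := by
    have := IsMultiplicative.comulPow_eq (X := X) hm rfl k
    rwa [Category.assoc] at this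
  refine ⟨inst, rfl, rfl, fun D γ => ?_, hpow⟩
  obtain ⟨g, hg⟩ := exists_factorization_of_isGreatest hc (isCompatible_comulProd D.X γ)
  have hgn (n : ℕ) : g ≫ c ≫ proj V n = comulPow D.X n ≫ tensorPowMap γ n := by
    rw [reassoc_of% hg, comulProd_proj]
  have : IsComonHom g :=
    { hom_counit := (hgn 0).trans (Category.comp_id _)
      hom_comul := hm.comp_comul hj (isMultiplicative_comulPow D.X γ) g hgn }
  refine ⟨Comon.Hom.mk g, ?_, fun f hf => Comon.ext ?_⟩
  · have := congrArg (· ≫ (tensorPowOne V).hom) (hgn 1)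
    rw [comulPow_one_comp, Category.assoc, Category.assoc] at this
    exact this
  -- Naturality of the iterated comultiplications expresses every component of `f` through `f.hom ≫
  -- p`, hence through `γ`; this gives uniqueness.
  · refine hj _ _ fun n => ?_
    have := comulPow_naturality (D := D.X) (X := X) f.hom
      (c ≫ proj V 1 ≫ (tensorPowOne V).hom) n
    rw [hpow] at this
    refine this.trans (Eq.trans ?_ (hgn n).symm)
    exact congrArg (fun t => comulPow D.X n ≫ tensorPowMap t n) hf

theorem exists_isCofree (V : C) : ∃ (T : Comon C) (p : T.X ⟶ V) (c : T.X ⟶ prodPow V) (_ : Mono c),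
    IsCofree V T p ∧ IsGreatest (compatibleSubobjects V) (Subobject.mk c) ∧
      ∀ k, comulPow T.X k ≫ tensorPowMap p k = c ≫ proj V k := by
  obtain ⟨S, hS⟩ := exists_isGreatest_compatibleSubobjects V
  obtain ⟨Δ, hΔ⟩ := hS.1
  have hS' : IsGreatest (compatibleSubobjects V) (Subobject.mk S.arrow) := by
    rwa [Subobject.mk_arrow]
  obtain ⟨h, -, -, hcof, hpow⟩ := exists_comonObj_of_isGreatest S.arrow hS' Δ hΔ
  exact ⟨Comon.mk (S : C), _, S.arrow, inferInstance, hcof, hS', hpow⟩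

/-- For every cofree coalgebra, the canonical morphism to `∏ₖ V^{⊗ k}` represents the largest
compatible subobject. -/
theorem IsCofree.isGreatest {T : Comon C} {p : T.X ⟶ V} (hT : IsCofree V T p) :
    ∃ _ : Mono (comulProd T.X p),
      IsGreatest (compatibleSubobjects V) (Subobject.mk (comulProd T.X p)) := by
  -- Compare `T` with the constructed cofree coalgebra: the two universal properties give an
  -- isomorphism over `V`, along which the subobject is transported.
  obtain ⟨X, q, c, _, hX, hc, hpow⟩ := exists_isCofree V
  obtain ⟨f, hf, -⟩ := hX T p
  obtain ⟨g, hg, -⟩ := hT X q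
  have hfg : f ≫ g = 𝟙 T := (hT T p).unique (by simp [hg, hf]) (by simp)
  have hgf : g ≫ f = 𝟙 X := (hX X q).unique (by simp [hg, hf]) (by simp)
  let e : T.X ≅ X.X := (Comon.forget C).mapIso ⟨f, g, hfg, hgf⟩
  have he : e.hom ≫ c = comulProd T.X p := by
    refine Pi.hom_ext _ _ fun n => ?_
    refine Eq.trans ?_ (comulProd_proj T.X p n).symm
    refine (Category.assoc _ _ _).trans ?_
    refine (congrArg (f.hom ≫ ·) (hpow n).symm).trans ?_
    rw [comulPow_naturality f.hom q n, hf]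
  have hmono : Mono (comulProd T.X p) := he ▸ inferInstance
  refine ⟨hmono, ?_⟩
  rwa [Subobject.mk_eq_mk_of_comm _ c e he]

theorem isLeftAdjoint_forget : (Comon.forget C).IsLeftAdjoint := by
  -- A cofree coalgebra over `V` is a terminal object of the comma category of the forgetful functor
  -- over `V`.
  have (V : C) : HasTerminal (CostructuredArrow (Comon.forget C) V) := by
    obtain ⟨T, p, -, -, hT, -⟩ := exists_isCofree V
    refine IsTerminal.hasTerminal (X := CostructuredArrow.mk (S := Comon.forget C) (Y := T) p)
      (IsTerminal.ofUniqueHom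
        (fun A => CostructuredArrow.homMk (hT A.left A.hom).choose
          (hT A.left A.hom).choose_spec.1)
        fun A m => CostructuredArrow.hom_ext _ _
          ((hT A.left A.hom).choose_spec.2 _ (CostructuredArrow.w m)))
  exact isLeftAdjoint_of_costructuredArrowTerminals _

end Cofree

end CofreeCoalgebra

theorem theorem2p4 {𝒱 : Type u} [Category.{v} 𝒱] [MonoidalCategory 𝒱] [MonoidalClosed 𝒱]
    [IsLocallyPresentable.{v} 𝒱] [CofreeCoalgebra.HasVeryFlatTensor 𝒱] (V : 𝒱) :
    -- a largest compatible subobject exists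
    (∃ S, IsGreatest (CofreeCoalgebra.compatibleSubobjects V) S) ∧
    -- the largest compatible subobject, with any compatible morphism, is the cofree coalgebra
    (∀ (X : 𝒱) (c : X ⟶ CofreeCoalgebra.prodPow V) [Mono c],
      IsGreatest (CofreeCoalgebra.compatibleSubobjects V) (Subobject.mk c) →
        (∃ Δ : X ⟶ X ⊗ X, CofreeCoalgebra.IsCompatible c Δ) ∧
        ∀ Δ : X ⟶ X ⊗ X, CofreeCoalgebra.IsCompatible c Δ →
          ∃ h : ComonObj X, h.comul = Δ ∧ h.counit = c ≫ CofreeCoalgebra.proj V 0 ∧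
            CofreeCoalgebra.IsCofree V (Comon.mk X)
              (c ≫ CofreeCoalgebra.proj V 1 ≫ (CofreeCoalgebra.tensorPowOne V).hom) ∧
            CofreeCoalgebra.JointlyMonic (fun k : ℕ =>
              CofreeCoalgebra.comulPow X k ≫ CofreeCoalgebra.tensorPowMap
                (c ≫ CofreeCoalgebra.proj V 1 ≫ (CofreeCoalgebra.tensorPowOne V).hom) k)) ∧
    -- the forgetful functor has a right adjoint, and every such adjunction is of this form
    (Comon.forget 𝒱).IsLeftAdjoint ∧
    (∀ (Tc : 𝒱 ⥤ Comon 𝒱) (adj : Comon.forget 𝒱 ⊣ Tc),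
      ∃ (c : (Tc.obj V).X ⟶ CofreeCoalgebra.prodPow V) (_ : Mono c),
        IsGreatest (CofreeCoalgebra.compatibleSubobjects V) (Subobject.mk c) ∧
        CofreeCoalgebra.IsCompatible c ComonObj.comul ∧
        (ComonObj.counit : (Tc.obj V).X ⟶ 𝟙_ 𝒱) = c ≫ CofreeCoalgebra.proj V 0 ∧
        adj.counit.app V =
          c ≫ CofreeCoalgebra.proj V 1 ≫ (CofreeCoalgebra.tensorPowOne V).hom ∧
        CofreeCoalgebra.JointlyMonic (fun k : ℕ =>
          CofreeCoalgebra.comulPow (Tc.obj V).X k ≫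
            CofreeCoalgebra.tensorPowMap (W := V) (adj.counit.app V) k)) := by
  refine ⟨CofreeCoalgebra.exists_isGreatest_compatibleSubobjects V, fun X c _ hc =>
    ⟨(CofreeCoalgebra.mk_mem_compatibleSubobjects_iff c).1 hc.1, fun Δ hΔ => ?_⟩,
    CofreeCoalgebra.isLeftAdjoint_forget, fun Tc adj => ?_⟩
  · obtain ⟨h, h₁, h₂, h₃, h₄⟩ := CofreeCoalgebra.exists_comonObj_of_isGreatest c hc Δ hΔ
    refine ⟨h, h₁, h₂, h₃, ?_⟩
    simp only [h₄]
    exact CofreeCoalgebra.jointlyMonic_comp_proj c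
  · obtain ⟨hmono, hgr⟩ := (CofreeCoalgebra.isCofree_of_adjunction adj V).isGreatest
    have hproj := CofreeCoalgebra.comulProd_proj (Tc.obj V).X (adj.counit.app V : _ ⟶ V)
    refine ⟨_, hmono, hgr, CofreeCoalgebra.isCompatible_comulProd _ _, ?_, ?_, ?_⟩
    · exact (Category.comp_id _).symm.trans (hproj 0).symm
    · refine (CofreeCoalgebra.comulPow_one_comp (Tc.obj V).X
        (adj.counit.app V : _ ⟶ V)).symm.trans ?_
      exact (congrArg (· ≫ (CofreeCoalgebra.tensorPowOne V).hom) (hproj 1).symm).trans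
        (Category.assoc _ _ _)
    · have := CofreeCoalgebra.jointlyMonic_comp_proj
        (CofreeCoalgebra.comulProd (Tc.obj V).X (adj.counit.app V : _ ⟶ V))
      simp only [hproj] at this
      exact this
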